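/- Let $G$ be a finite connected graph with node set $\mathcal N$, without self-loops or multiple links, in which every link $(i,j)$ carries a weight $c_{ij}=c_{ji}>0$, and put $c_{ij}=0$ when $i,j$ are not linked. Let $Q$ be its weighted Laplacian, $Q_{ii}=\sum_k c_{ik}$ and $Q_{ij}=-c_{ij}$ for $i\neq j$, let $Q^\dagger$ be the Moore–Penrose inverse of $Q$, and let $\omega_{ij}=(e_i-e_j)^{T}Q^\dagger(e_i-e_j)$ be the effective resistance. For a probability distribution $p$ on $\mathcal N$ put $\operatorname{var}_\omega(p)=\tfrac12\sum_{i,j}p_ip_j\,\omega_{ij}$. Then there is exactly one probability distribution $p^\star$ that maximizes $\operatorname{var}_\omega$ over all probability distributions on $\mathcal N$. Let $\mathcal V^\star=\{i\in\mathcal N: p^\star_i>0\}$ be its support. For any two distinct nodes $a,b$ the following are equivalent: 1. $\mathcal V^\star=\{a,b\}$; 2. $G$ (with its weights disregarded) is a path graph whose two ends are $a$ and $b$; 3. $\omega_{ax}+\omega_{xb}=\omega_{ab}$ for every node $x\notin\{a,b\}$. In particular, $\mathcal V^\star$ consists of exactly two nodes if and only if $G$ is a path graph with at least two nodes. -/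

import Mathlib

/-! ### The Moore–Penrose inverse of a real matrix -/

/-- `X` satisfies the four Penrose equations for `A`. -/
structure IsMoorePenroseInverse {m n : Type*} [Fintype m] [Fintype n]
    (A : Matrix m n ℝ) (X : Matrix n m ℝ) : Prop where
  mul_mul_left : A * X * A = A
  mul_mul_right : X * A * X = X
  symm_left : (A * X).transpose = A * X
  symm_right : (X * A).transpose = X * A

theorem IsMoorePenroseInverse.unique {m n : Type*} [Fintype m] [Fintype n]
    {A : Matrix m n ℝ} {X Y : Matrix n m ℝ}
    (hX : IsMoorePenroseInverse A X) (hY : IsMoorePenroseInverse A Y) : X = Y := by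
  have h1 : A * X = A * Y := by
    have e : (A * Y * (A * X)).transpose = A * X * (A * Y) := by
      rw [Matrix.transpose_mul, hX.symm_left, hY.symm_left]
    rw [← Matrix.mul_assoc, hY.mul_mul_left, ← Matrix.mul_assoc, hX.mul_mul_left,
      hX.symm_left] at e
    exact e
  have h2 : X * A = Y * A := by
    have e : (X * A * (Y * A)).transpose = Y * A * (X * A) := by
      rw [Matrix.transpose_mul, hX.symm_right, hY.symm_right]
    rw [Matrix.mul_assoc, ← Matrix.mul_assoc A, hY.mul_mul_left, Matrix.mul_assoc Y,
      ← Matrix.mul_assoc A, hX.mul_mul_left, hX.symm_right] at e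
    exact e
  calc X = X * A * X := hX.mul_mul_right.symm
    _ = Y * A * X := by rw [h2]
    _ = Y * (A * X) := Matrix.mul_assoc _ _ _
    _ = Y * A * Y := by rw [h1, Matrix.mul_assoc]
    _ = Y := hY.mul_mul_right

theorem exists_isMoorePenroseInverse_of_isHermitian {n : Type*} [Fintype n] [DecidableEq n]
    {A : Matrix n n ℝ} (hA : A.IsHermitian) :
    ∃ X : Matrix n n ℝ, IsMoorePenroseInverse A X := by
  obtain ⟨U, d, hU, hAe⟩ : ∃ (U : Matrix n n ℝ) (d : n → ℝ),
      U.transpose * U = 1 ∧ A = U * Matrix.diagonal d * U.transpose := by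
    refine ⟨(hA.eigenvectorUnitary : Matrix n n ℝ), hA.eigenvalues, ?_, ?_⟩
    · have := Matrix.mem_unitaryGroup_iff'.1 hA.eigenvectorUnitary.2
      simpa [Matrix.star_eq_conjTranspose, Matrix.conjTranspose_eq_transpose_of_trivial] using this
    · have := hA.spectral_theorem
      simpa [Unitary.conjStarAlgAut_apply, Matrix.star_eq_conjTranspose,
        Matrix.conjTranspose_eq_transpose_of_trivial, Function.comp_def] using this
  have key : ∀ a b : n → ℝ, U * Matrix.diagonal a * U.transpose *
      (U * Matrix.diagonal b * U.transpose) =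
        U * Matrix.diagonal (fun i => a i * b i) * U.transpose := by
    intro a b
    calc _ = U * Matrix.diagonal a * (U.transpose * U) * Matrix.diagonal b * U.transpose := by
          simp only [Matrix.mul_assoc]
      _ = _ := by
          rw [hU, Matrix.mul_one, Matrix.mul_assoc U, Matrix.diagonal_mul_diagonal]
  have keyT : ∀ a : n → ℝ, (U * Matrix.diagonal a * U.transpose).transpose =
      U * Matrix.diagonal a * U.transpose := by
    intro a
    simp [Matrix.transpose_mul, Matrix.mul_assoc]
  refine ⟨U * Matrix.diagonal (fun i => (d i)⁻¹) * U.transpose, ?_, ?_, ?_, ?_⟩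
  · rw [hAe, key, key]
    simp
  · rw [hAe, key, key]
    congr 3
    funext i
    by_cases h : d i = 0 <;> simp [h]
  · rw [hAe, key, keyT]
  · rw [hAe, key, keyT]

theorem IsMoorePenroseInverse.transpose_eq {n : Type*} [Fintype n]
    {A X : Matrix n n ℝ} (hX : IsMoorePenroseInverse A X) (hA : A.transpose = A) :
    X.transpose = X := by
  have h1 : (A * X).transpose = X.transpose * A := by rw [Matrix.transpose_mul, hA]
  have h2 : (X * A).transpose = A * X.transpose := by rw [Matrix.transpose_mul, hA]
  refine IsMoorePenroseInverse.unique (A := A) ⟨?_, ?_, ?_, ?_⟩ hX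
  · have := congrArg Matrix.transpose hX.mul_mul_left
    rwa [Matrix.transpose_mul, h1, hA, ← Matrix.mul_assoc] at this
  · have := congrArg Matrix.transpose hX.mul_mul_right
    rwa [Matrix.transpose_mul, h2, ← Matrix.mul_assoc] at this
  · rw [← h2, hX.symm_right, hX.symm_right]
  · rw [← h1, hX.symm_left, hX.symm_left]

theorem exists_isMoorePenroseInverse {m n : Type*} [Fintype m] [Fintype n]
    (A : Matrix m n ℝ) : ∃ X : Matrix n m ℝ, IsMoorePenroseInverse A X := by
  classical
  have hH : (A.transpose * A).IsHermitian := by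
    rw [← Matrix.conjTranspose_eq_transpose_of_trivial]
    exact Matrix.isHermitian_conjTranspose_mul_self A
  have hHT : (A.transpose * A).transpose = A.transpose * A := by
    simp [Matrix.transpose_mul]
  obtain ⟨B, hB⟩ := exists_isMoorePenroseInverse_of_isHermitian hH
  have hBT : B.transpose = B := hB.transpose_eq hHT
  have h1 : A * B * (A.transpose * A) = A := by
    have e1 : A.transpose * (A * (B * (A.transpose * A) - 1)) = 0 := by
      rw [← Matrix.mul_assoc, Matrix.mul_sub, ← Matrix.mul_assoc (A.transpose * A) B,
        hB.mul_mul_left, Matrix.mul_one, sub_self]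
    have h0 : (A * (B * (A.transpose * A) - 1)).conjTranspose *
        (A * (B * (A.transpose * A) - 1)) = 0 := by
      rw [Matrix.conjTranspose_eq_transpose_of_trivial, Matrix.transpose_mul, Matrix.mul_assoc,
        e1, Matrix.mul_zero]
    have h2 := Matrix.conjTranspose_mul_self_eq_zero.1 h0
    rw [Matrix.mul_sub, Matrix.mul_one, ← Matrix.mul_assoc] at h2
    exact sub_eq_zero.1 h2
  refine ⟨B * A.transpose, ?_, ?_, ?_, ?_⟩
  · rw [← Matrix.mul_assoc, Matrix.mul_assoc, h1]
  · have := hB.mul_mul_right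
    calc _ = B * (A.transpose * A) * B * A.transpose := by simp only [Matrix.mul_assoc]
      _ = _ := by rw [this]
  · simp [Matrix.transpose_mul, hBT, Matrix.mul_assoc]
  · rw [Matrix.mul_assoc, hB.symm_right]

/-- The Moore–Penrose inverse of a real matrix. -/
noncomputable def moorePenroseInverse {m n : Type*} [Fintype m] [Fintype n]
    (A : Matrix m n ℝ) : Matrix n m ℝ :=
  (exists_isMoorePenroseInverse A).choose

theorem isMoorePenroseInverse_moorePenroseInverse {m n : Type*} [Fintype m] [Fintype n]
    (A : Matrix m n ℝ) : IsMoorePenroseInverse A (moorePenroseInverse A) :=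
  (exists_isMoorePenroseInverse A).choose_spec

/-! ### Weighted graphs, effective resistance, variance -/

/-- A simple graph whose links carry positive real weights; the weight of a pair of nodes that is
not a link is `0`. -/
structure WeightedGraph (V : Type*) where
  graph : SimpleGraph V
  weight : V → V → ℝ
  weight_symm : ∀ i j, weight i j = weight j i
  weight_pos : ∀ i j, graph.Adj i j → 0 < weight i j
  weight_eq_zero : ∀ i j, ¬ graph.Adj i j → weight i j = 0

namespace WeightedGraph

/-- The graph is a path whose ends are `a` and `b`. -/
def IsPathWithEnds {V : Type*} (G : WeightedGraph V) (a b : V) : Prop :=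
  ∃ (n : ℕ) (e : SimpleGraph.pathGraph (n + 1) ≃g G.graph), e 0 = a ∧ e (Fin.last n) = b

variable {V : Type*} [Fintype V] [DecidableEq V]

/-- The weighted Laplacian matrix `Q`. -/
def laplacian (G : WeightedGraph V) : Matrix V V ℝ :=
  Matrix.of fun i j => if i = j then ∑ k, G.weight i k else -G.weight i j

/-- The effective resistance `ω i j = (eᵢ - eⱼ)ᵀ Q† (eᵢ - eⱼ)`. -/
noncomputable def resistance (G : WeightedGraph V) (i j : V) : ℝ :=
  (Pi.single i 1 - Pi.single j 1 : V → ℝ) ⬝ᵥ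
    (moorePenroseInverse G.laplacian).mulVec (Pi.single i 1 - Pi.single j 1 : V → ℝ)

/-- The variance `½ ∑ᵢⱼ pᵢ pⱼ d(i,j)²` of `p` for the distance `d = √ω`, that is,
`½ pᵀ Ω p` with `Ω = (ωᵢⱼ)`. -/
noncomputable def variance (G : WeightedGraph V) (p : V → ℝ) : ℝ :=
  (1 / 2) * ∑ i, ∑ j, p i * p j * G.resistance i j

/-- `p` is a probability distribution on the nodes that has the largest variance among all
probability distributions on the nodes. -/
def IsMaxVarianceDistribution (G : WeightedGraph V) (p : V → ℝ) : Prop :=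
  p ∈ stdSimplex ℝ V ∧ ∀ q ∈ stdSimplex ℝ V, G.variance q ≤ G.variance p

end WeightedGraph

/-!
The Laplacian pseudoinverse is positive semidefinite and inverts the Laplacian on vectors with sum
zero, so the resistance matrix `Ω` is negative definite on those vectors. The variance is therefore
strictly concave on the simplex: its maximizer is unique and is characterized by the first-order
condition `(Ω p) i ≤ p ⬝ᵥ Ω *ᵥ p` for all `i`. A maximizer supported on `{a, b}` must put mass
`1 / 2` on each of `a` and `b`, and for that `p` the condition reads `ω a i + ω i b ≤ ω a b`, i.e.
equality in the triangle inequality.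

The defect `ω a x + ω x b - ω a b` is twice the potential at `a` of the unit current from `b` to `x`
grounded at `x`. By the minimum principle it is nonnegative, and it vanishes exactly when every
walk from `a` to `b` passes through `x`. All vertices lie on every walk from `a` to `b` exactly when
a shortest such walk exhausts the graph, that is, when the graph is a path with ends `a` and `b`.
-/

namespace IsMoorePenroseInverse

open Matrix

variable {m n : Type*} [Fintype m] [Fintype n]

theorem transpose_mulVec_mulVec_mulVec {A : Matrix m n ℝ} {X : Matrix n m ℝ}
    (hX : IsMoorePenroseInverse A X) (d : m → ℝ) : Aᵀ *ᵥ (A *ᵥ (X *ᵥ d)) = Aᵀ *ᵥ d := by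
  rw [mulVec_mulVec _ A, mulVec_mulVec, ← hX.symm_left, ← transpose_mul, hX.mul_mul_left]

theorem mulVec_mulVec_eq_self {A : Matrix m n ℝ} {X : Matrix n m ℝ}
    (hX : IsMoorePenroseInverse A X) {d : m → ℝ} (hd : ∀ z, Aᵀ *ᵥ z = 0 → z ⬝ᵥ d = 0) :
    A *ᵥ (X *ᵥ d) = d := by
  set r := d - A *ᵥ (X *ᵥ d) with hr
  have hr_ker : Aᵀ *ᵥ r = 0 := by
    rw [hr, mulVec_sub, hX.transpose_mulVec_mulVec_mulVec, sub_self]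
  have hr_self : r ⬝ᵥ r = 0 := by
    calc r ⬝ᵥ r = r ⬝ᵥ d - (Aᵀ *ᵥ r) ⬝ᵥ (X *ᵥ d) := by
          rw [mulVec_transpose, ← dotProduct_mulVec, ← dotProduct_sub]
      _ = 0 := by rw [hd r hr_ker, hr_ker, zero_dotProduct, sub_zero]
  exact (sub_eq_zero.1 (dotProduct_self_eq_zero.1 hr_self)).symm

theorem posSemidef {A X : Matrix n n ℝ} (hX : IsMoorePenroseInverse A X) (hA : A.PosSemidef) :
    X.PosSemidef := by
  have hXT : Xᴴ = X := hX.transpose_eq hA.isHermitian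
  have h := hA.mul_mul_conjTranspose_same X
  rwa [hXT, hX.mul_mul_right] at h

end IsMoorePenroseInverse

section QuadraticFormOnSimplex

open Matrix

variable {n : Type*} [Fintype n] {D : Matrix n n ℝ} {p q : n → ℝ}

/-- A real matrix is conditionally negative definite if it is symmetric and its quadratic form is
negative on the nonzero vectors with coordinate sum zero. -/
structure IsCondNegDef (D : Matrix n n ℝ) : Prop where
  isSymm : D.IsSymm
  dotProduct_mulVec_neg : ∀ d : n → ℝ, ∑ i, d i = 0 → d ≠ 0 → d ⬝ᵥ D *ᵥ d < 0

/-- `p` maximizes the quadratic form of `D` over the standard simplex. -/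
def IsSimplexMaximizer (D : Matrix n n ℝ) (p : n → ℝ) : Prop :=
  p ∈ stdSimplex ℝ n ∧ IsMaxOn (fun q => q ⬝ᵥ D *ᵥ q) (stdSimplex ℝ n) p

theorem sum_sub_eq_zero_of_mem_stdSimplex (hp : p ∈ stdSimplex ℝ n) (hq : q ∈ stdSimplex ℝ n) :
    ∑ i, (q - p) i = 0 := by
  simp [Finset.sum_sub_distrib, hp.2, hq.2]

theorem dotProduct_le_of_mem_stdSimplex (hq : q ∈ stdSimplex ℝ n) {f : n → ℝ} {c : ℝ}
    (hf : ∀ i, f i ≤ c) : q ⬝ᵥ f ≤ c :=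
  calc q ⬝ᵥ f ≤ ∑ i, q i * c :=
        Finset.sum_le_sum fun i _ => mul_le_mul_of_nonneg_left (hf i) (hq.1 i)
    _ = c := by rw [← Finset.sum_mul, hq.2, one_mul]

theorem exists_isSimplexMaximizer [Nonempty n] (D : Matrix n n ℝ) :
    ∃ p, IsSimplexMaximizer D p := by
  classical
  refine (isCompact_stdSimplex ℝ n).exists_isMaxOn
    ⟨_, single_mem_stdSimplex ℝ (Classical.arbitrary n)⟩ (Continuous.continuousOn ?_)
  fun_prop

theorem dotProduct_mulVec_comm_of_isSymm (hD : D.IsSymm) (p q : n → ℝ) :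
    p ⬝ᵥ D *ᵥ q = q ⬝ᵥ D *ᵥ p := by
  rw [dotProduct_mulVec, ← mulVec_transpose, hD.eq, dotProduct_comm]

theorem quadraticForm_add (hD : D.IsSymm) (p d : n → ℝ) :
    (p + d) ⬝ᵥ D *ᵥ (p + d) = p ⬝ᵥ D *ᵥ p + 2 * (d ⬝ᵥ D *ᵥ p) + d ⬝ᵥ D *ᵥ d := by
  rw [mulVec_add, add_dotProduct, dotProduct_add, dotProduct_add,
    dotProduct_mulVec_comm_of_isSymm hD p d]
  ring

theorem IsCondNegDef.strictConcaveOn (hD : IsCondNegDef D) :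
    StrictConcaveOn ℝ (stdSimplex ℝ n) fun q => q ⬝ᵥ D *ᵥ q := by
  refine ⟨convex_stdSimplex ℝ n, fun p hp q hq hpq s t hs ht hst => ?_⟩
  have hneg := hD.dotProduct_mulVec_neg _ (sum_sub_eq_zero_of_mem_stdSimplex hp hq)
    (sub_ne_zero.2 hpq.symm)
  have hq_expand := quadraticForm_add hD.isSymm p (q - p)
  have hst_expand := quadraticForm_add hD.isSymm p (t • (q - p))
  obtain rfl : s = 1 - t := eq_sub_of_add_eq hst
  have hcomb : (1 - t) • p + t • q = p + t • (q - p) := by module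
  simp only [add_sub_cancel] at hq_expand
  simp only [mulVec_smul, smul_dotProduct, dotProduct_smul, smul_eq_mul] at hst_expand ⊢
  rw [hcomb, hst_expand, hq_expand]
  linarith [mul_neg_of_pos_of_neg (mul_pos hs ht) hneg]

theorem IsSimplexMaximizer.unique (hD : IsCondNegDef D) (hp : IsSimplexMaximizer D p)
    (hq : IsSimplexMaximizer D q) : p = q :=
  hD.strictConcaveOn.eq_of_isMaxOn hp.2 hq.2 hp.1 hq.1

theorem IsSimplexMaximizer.dotProduct_sub_nonpos (hD : D.IsSymm) (hp : IsSimplexMaximizer D p)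
    (hq : q ∈ stdSimplex ℝ n) : (q - p) ⬝ᵥ D *ᵥ p ≤ 0 := by
  have hslope : ∀ t ∈ Set.Ioc (0 : ℝ) 1,
      2 * ((q - p) ⬝ᵥ D *ᵥ p) + t * ((q - p) ⬝ᵥ D *ᵥ (q - p)) ≤ 0 := by
    intro t ht
    have hmax := hp.2 ((convex_stdSimplex ℝ n).add_smul_sub_mem hp.1 hq ⟨ht.1.le, ht.2⟩)
    simp only [Set.mem_ofPred_eq, quadraticForm_add hD, mulVec_smul, smul_dotProduct,
      dotProduct_smul, smul_eq_mul] at hmax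
    exact nonpos_of_mul_nonpos_right (a := t) (by linarith) ht.1
  have hlim : Filter.Tendsto
      (fun t : ℝ => 2 * ((q - p) ⬝ᵥ D *ᵥ p) + t * ((q - p) ⬝ᵥ D *ᵥ (q - p)))
      (nhdsWithin 0 (Set.Ioi 0)) (nhds (2 * ((q - p) ⬝ᵥ D *ᵥ p))) :=
    tendsto_nhdsWithin_of_tendsto_nhds (Continuous.tendsto' (by fun_prop) _ _ (by simp))
  have := le_of_tendsto hlim (Filter.eventually_of_mem (Ioc_mem_nhdsGT one_pos) hslope)
  linarith

theorem IsCondNegDef.isSimplexMaximizer_iff (hD : IsCondNegDef D) (hp : p ∈ stdSimplex ℝ n) :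
    IsSimplexMaximizer D p ↔ ∀ i, (D *ᵥ p) i ≤ p ⬝ᵥ D *ᵥ p := by
  classical
  refine ⟨fun hmax i => ?_, fun h => ⟨hp, isMaxOn_iff.2 fun q hq => ?_⟩⟩
  · have := hmax.dotProduct_sub_nonpos hD.isSymm (single_mem_stdSimplex ℝ i)
    rwa [sub_dotProduct, single_one_dotProduct, sub_nonpos] at this
  · obtain rfl | hqp := eq_or_ne q p
    · exact le_rfl
    have hneg := hD.dotProduct_mulVec_neg _ (sum_sub_eq_zero_of_mem_stdSimplex hp hq)
      (sub_ne_zero.2 hqp)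
    have hexpand := quadraticForm_add hD.isSymm p (q - p)
    have hslope := dotProduct_le_of_mem_stdSimplex hq h
    rw [add_sub_cancel, sub_dotProduct q p] at hexpand
    linarith

variable [DecidableEq n] {a b : n}

/-- The probability vector that puts mass `1 / 2` on each of two distinct indices `a`, `b`. -/
noncomputable def uniformPair (a b : n) : n → ℝ := (1 / 2 : ℝ) • (Pi.single a 1 + Pi.single b 1)

theorem uniformPair_mem_stdSimplex (a b : n) : uniformPair a b ∈ stdSimplex ℝ n := by
  rw [uniformPair, smul_add]
  exact convex_stdSimplex ℝ n (single_mem_stdSimplex ℝ a) (single_mem_stdSimplex ℝ b)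
    (by norm_num) (by norm_num) (by norm_num)

omit [Fintype n] in
theorem setOf_uniformPair_pos (hab : a ≠ b) : {i | 0 < uniformPair a b i} = {a, b} := by
  ext i
  obtain rfl | hia := eq_or_ne i a
  · simp [uniformPair, hab]
  obtain rfl | hib := eq_or_ne i b <;> simp [uniformPair, *]

theorem mulVec_uniformPair (D : Matrix n n ℝ) (a b i : n) :
    (D *ᵥ uniformPair a b) i = (D i a + D i b) / 2 := by
  simp only [uniformPair, mulVec_smul, mulVec_add, mulVec_single_one, Pi.smul_apply, Pi.add_apply,
    col_apply, smul_eq_mul]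
  ring

theorem quadraticForm_smul_single_add_smul_single (hD : D.IsSymm) (hdiag : ∀ i, D i i = 0)
    (a b : n) (s t : ℝ) :
    (s • Pi.single a 1 + t • Pi.single b 1) ⬝ᵥ D *ᵥ (s • Pi.single a 1 + t • Pi.single b 1) =
      2 * (s * t) * D a b := by
  simp only [mulVec_add, mulVec_smul, mulVec_single_one, dotProduct_add, dotProduct_smul,
    add_dotProduct, smul_dotProduct, single_one_dotProduct, col_apply, hdiag, smul_eq_mul,
    hD.apply a b]
  ring

theorem quadraticForm_uniformPair (hD : D.IsSymm) (hdiag : ∀ i, D i i = 0) (a b : n) :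
    uniformPair a b ⬝ᵥ D *ᵥ uniformPair a b = D a b / 2 := by
  rw [uniformPair, smul_add, quadraticForm_smul_single_add_smul_single hD hdiag]
  ring

omit [DecidableEq n] in
theorem IsCondNegDef.apply_pos (hD : IsCondNegDef D) (hdiag : ∀ i, D i i = 0) (hab : a ≠ b) :
    0 < D a b := by
  classical
  have hne : (Pi.single a 1 - Pi.single b 1 : n → ℝ) ≠ 0 := fun h => by
    simpa [hab] using congrFun h a
  have hneg := hD.dotProduct_mulVec_neg _ (by simp [Finset.sum_sub_distrib]) hne
  simp only [mulVec_sub, mulVec_single_one, dotProduct_sub, sub_dotProduct, single_one_dotProduct,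
    col_apply, hdiag, hD.isSymm.apply a b] at hneg
  linarith

theorem eq_smul_single_add_smul_single_of_mem_stdSimplex (hab : a ≠ b) (hp : p ∈ stdSimplex ℝ n)
    (hsupp : {i | 0 < p i} ⊆ {a, b}) :
    p = p a • Pi.single a 1 + (1 - p a) • Pi.single b 1 := by
  have hzero : ∀ i, i ≠ a ∧ i ≠ b → p i = 0 := fun i hi =>
    le_antisymm (not_lt.1 fun h => (hsupp h).elim hi.1 hi.2) (hp.1 i)
  have hsum : p a + p b = 1 := by
    rw [← hp.2, Fintype.sum_eq_add a b hab hzero]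
  ext i
  obtain rfl | hia := eq_or_ne i a
  · simp [hab]
  obtain rfl | hib := eq_or_ne i b
  · simp [hia, eq_sub_of_add_eq' hsum]
  · simp [hia, hib, hzero i ⟨hia, hib⟩]

theorem IsSimplexMaximizer.eq_uniformPair (hD : IsCondNegDef D) (hdiag : ∀ i, D i i = 0)
    (hp : IsSimplexMaximizer D p) (hab : a ≠ b) (hsupp : {i | 0 < p i} ⊆ {a, b}) :
    p = uniformPair a b := by
  have hp_eq := eq_smul_single_add_smul_single_of_mem_stdSimplex hab hp.1 hsupp
  set s := p a
  have hle : D a b / 2 ≤ 2 * (s * (1 - s)) * D a b := by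
    rw [← quadraticForm_uniformPair hD.isSymm hdiag,
      ← quadraticForm_smul_single_add_smul_single hD.isSymm hdiag, ← hp_eq]
    exact hp.2 (uniformPair_mem_stdSimplex a b)
  have hs : (2 * s - 1) ^ 2 ≤ 0 := by
    refine nonpos_of_mul_nonpos_right (a := D a b) ?_ (hD.apply_pos hdiag hab)
    linarith
  have hs_half : s = 1 / 2 := by
    have := pow_eq_zero_iff two_ne_zero |>.1 (le_antisymm hs (sq_nonneg _))
    linarith
  rw [hp_eq, hs_half, uniformPair, smul_add]
  norm_num

theorem IsCondNegDef.isSimplexMaximizer_uniformPair_iff (hD : IsCondNegDef D)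
    (hdiag : ∀ i, D i i = 0) (a b : n) :
    IsSimplexMaximizer D (uniformPair a b) ↔ ∀ i, D a i + D i b ≤ D a b := by
  rw [hD.isSimplexMaximizer_iff (uniformPair_mem_stdSimplex a b)]
  refine forall_congr' fun i => ?_
  rw [mulVec_uniformPair, quadraticForm_uniformPair hD.isSymm hdiag, hD.isSymm.apply a i]
  constructor <;> intro h <;> linarith

omit [DecidableEq n] in
theorem IsSimplexMaximizer.setOf_pos_eq_pair_iff (hD : IsCondNegDef D) (hdiag : ∀ i, D i i = 0)
    (hp : IsSimplexMaximizer D p) (hab : a ≠ b) :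
    {i | 0 < p i} = {a, b} ↔ ∀ i, D a i + D i b ≤ D a b := by
  classical
  rw [← hD.isSimplexMaximizer_uniformPair_iff hdiag]
  constructor
  · intro hsupp
    rwa [← hp.eq_uniformPair hD hdiag hab hsupp.subset]
  · intro hmax
    rw [hp.unique hD hmax, setOf_uniformPair_pos hab]

end QuadraticFormOnSimplex

section PathGraph

variable {V : Type*} {G : SimpleGraph V} {a b : V}

theorem mem_support_of_pathGraph_iso {n : ℕ} (e : SimpleGraph.pathGraph (n + 1) ≃g G)
    (k : Fin (n + 1)) (w : G.Walk (e 0) (e (Fin.last n))) : e k ∈ w.support := by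
  obtain rfl | hk := eq_or_ne k 0
  · exact w.start_mem_support
  obtain ⟨d, hd, hfst, hsnd⟩ := w.exists_boundary_dart {v | e.symm v < k}
    (by simpa using Fin.pos_iff_ne_zero.2 hk) (by simpa using Fin.le_last k)
  have hadj := e.symm.map_adj_iff.2 d.adj
  rw [SimpleGraph.pathGraph_adj] at hadj
  have hk_eq : e.symm d.snd = k := by
    simp only [Set.mem_ofPred_eq, not_lt, Fin.lt_def] at hfst hsnd
    omega
  rw [← hk_eq, e.apply_symm_apply]
  exact w.dart_snd_mem_support_of_mem_darts hd

theorem dist_getVert_of_length_eq_dist {w : G.Walk a b} (hw : w.length = G.dist a b) {i : ℕ}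
    (hi : i ≤ w.length) : G.dist a (w.getVert i) = i := by
  rw [← SimpleGraph.length_eq_dist_of_subwalk hw (w.isSubwalk_take i),
    SimpleGraph.Walk.take_length, min_eq_left hi]

theorem adj_getVert_iff_of_length_eq_dist {w : G.Walk a b} (hw : w.length = G.dist a b) {i j : ℕ}
    (hi : i ≤ w.length) (hj : j ≤ w.length) :
    G.Adj (w.getVert i) (w.getVert j) ↔ i + 1 = j ∨ j + 1 = i := by
  constructor
  · intro hadj
    have hne : i ≠ j := fun h => hadj.ne (congrArg w.getVert h)
    have hdist := hadj.diff_dist_adj (u := a)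
    rw [dist_getVert_of_length_eq_dist hw hi, dist_getVert_of_length_eq_dist hw hj] at hdist
    omega
  · rintro (rfl | rfl)
    · exact w.adj_getVert_succ hj
    · exact (w.adj_getVert_succ hi).symm

theorem exists_pathGraph_iso_of_length_eq_dist {w : G.Walk a b} (hw : w.length = G.dist a b)
    (hsupp : ∀ x, x ∈ w.support) :
    ∃ e : SimpleGraph.pathGraph (w.length + 1) ≃g G, e 0 = a ∧ e (Fin.last w.length) = b := by
  have hinj : Function.Injective fun i : Fin (w.length + 1) => w.getVert i := fun i j hij => by
    have hdist := congrArg (G.dist a) hij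
    simp only [dist_getVert_of_length_eq_dist hw i.is_le,
      dist_getVert_of_length_eq_dist hw j.is_le] at hdist
    exact Fin.ext hdist
  have hsurj : Function.Surjective fun i : Fin (w.length + 1) => w.getVert i := fun x => by
    obtain ⟨i, hi, hle⟩ := SimpleGraph.Walk.mem_support_iff_exists_getVert.1 (hsupp x)
    exact ⟨⟨i, Nat.lt_succ_of_le hle⟩, hi⟩
  refine ⟨⟨Equiv.ofBijective _ ⟨hinj, hsurj⟩, fun {i j} => ?_⟩, w.getVert_zero, w.getVert_length⟩
  rw [SimpleGraph.pathGraph_adj]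
  exact adj_getVert_iff_of_length_eq_dist hw i.is_le j.is_le

end PathGraph

namespace WeightedGraph

open Matrix

variable {V : Type*} {G : WeightedGraph V}

theorem weight_nonneg (G : WeightedGraph V) (i j : V) : 0 ≤ G.weight i j := by
  by_cases h : G.graph.Adj i j
  · exact (G.weight_pos i j h).le
  · exact (G.weight_eq_zero i j h).ge

theorem isPathWithEnds_iff_forall_mem_support (hG : G.graph.Connected) {a b : V} :
    G.IsPathWithEnds a b ↔ ∀ (x : V) (w : G.graph.Walk a b), x ∈ w.support := by
  constructor
  · rintro ⟨n, e, rfl, rfl⟩ x w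
    rw [← e.apply_symm_apply x]
    exact mem_support_of_pathGraph_iso e _ w
  · intro h
    obtain ⟨w, hw⟩ := hG.exists_walk_length_eq_dist a b
    exact ⟨w.length, exists_pathGraph_iso_of_length_eq_dist hw (h · w)⟩

section Laplacian

variable [Fintype V] [DecidableEq V]

theorem laplacian_isSymm (G : WeightedGraph V) : G.laplacian.IsSymm := by
  ext i j
  obtain rfl | h := eq_or_ne i j
  · rfl
  · simp [laplacian, h, h.symm, G.weight_symm i j]

theorem laplacian_mulVec (G : WeightedGraph V) (f : V → ℝ) (i : V) :
    (G.laplacian *ᵥ f) i = ∑ j, G.weight i j * (f i - f j) := by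
  have hentry : ∀ j, G.laplacian i j * f j =
      (if i = j then (∑ k, G.weight i k) * f i else 0) - G.weight i j * f j := by
    intro j
    obtain rfl | h := eq_or_ne i j
    · simp [laplacian, G.weight_eq_zero i i G.graph.irrefl]
    · simp [laplacian, h]
  simp only [mulVec, dotProduct, hentry, Finset.sum_sub_distrib, mul_sub, Finset.sum_mul,
    Finset.sum_ite_eq, Finset.mem_univ, if_true]

theorem dotProduct_laplacian_mulVec_self (G : WeightedGraph V) (f : V → ℝ) :
    f ⬝ᵥ G.laplacian *ᵥ f = (1 / 2) * ∑ i, ∑ j, G.weight i j * (f i - f j) ^ 2 := by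
  have hsum : f ⬝ᵥ G.laplacian *ᵥ f = ∑ i, ∑ j, G.weight i j * (f i * (f i - f j)) := by
    simp only [dotProduct, laplacian_mulVec, Finset.mul_sum, mul_left_comm]
  have hswap : f ⬝ᵥ G.laplacian *ᵥ f = ∑ i, ∑ j, G.weight i j * (f j * (f j - f i)) := by
    rw [hsum, Finset.sum_comm]
    simp only [G.weight_symm]
  have hadd : ∑ i, ∑ j, G.weight i j * (f i - f j) ^ 2 =
      f ⬝ᵥ G.laplacian *ᵥ f + f ⬝ᵥ G.laplacian *ᵥ f := by
    nth_rw 1 [hsum]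
    rw [hswap]
    simp only [← Finset.sum_add_distrib]
    exact Finset.sum_congr rfl fun i _ => Finset.sum_congr rfl fun j _ => by ring
  rw [hadd]
  ring

theorem laplacian_posSemidef (G : WeightedGraph V) : G.laplacian.PosSemidef := by
  refine .of_dotProduct_mulVec_nonneg G.laplacian_isSymm fun f => ?_
  rw [star_trivial, dotProduct_laplacian_mulVec_self]
  exact mul_nonneg (by norm_num) (Finset.sum_nonneg fun i _ => Finset.sum_nonneg fun j _ =>
    mul_nonneg (G.weight_nonneg i j) (sq_nonneg _))

theorem eq_of_adj_of_forall_le {f : V → ℝ} {u v : V} (hmin : ∀ i, f u ≤ f i)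
    (hu : 0 ≤ (G.laplacian *ᵥ f) u) (huv : G.graph.Adj u v) : f v = f u := by
  have hterm : ∀ j ∈ Finset.univ, G.weight u j * (f u - f j) ≤ 0 := fun j _ =>
    mul_nonpos_of_nonneg_of_nonpos (G.weight_nonneg u j) (sub_nonpos.2 (hmin j))
  rw [laplacian_mulVec] at hu
  have hzero := (Finset.sum_eq_zero_iff_of_nonpos hterm).1
    (le_antisymm (Finset.sum_nonpos hterm) hu) v (Finset.mem_univ v)
  exact (sub_eq_zero.1 ((mul_eq_zero.1 hzero).resolve_left (G.weight_pos u v huv).ne')).symm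

theorem eq_of_walk_of_forall_le {f : V → ℝ} {u v : V} (w : G.graph.Walk u v)
    (hmin : ∀ i, f u ≤ f i) (hw : ∀ i ∈ w.support, i ≠ v → 0 ≤ (G.laplacian *ᵥ f) i) :
    f v = f u := by
  induction w with
  | nil => rfl
  | @cons u u' v hadj w ih =>
    obtain rfl | huv := eq_or_ne u v
    · rfl
    have hu' : f u' = f u := eq_of_adj_of_forall_le hmin (hw u (by simp) huv) hadj
    rw [ih (fun i => hu'.trans_le (hmin i)) fun i hi => hw i (by simp [hi]), hu']

theorem le_of_laplacian_mulVec_nonneg (hG : G.graph.Connected) {f : V → ℝ} {x : V}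
    (hf : ∀ i, i ≠ x → 0 ≤ (G.laplacian *ᵥ f) i) (i : V) : f x ≤ f i := by
  have := hG.nonempty
  obtain ⟨u, hu⟩ := Finite.exists_min f
  obtain ⟨w⟩ := hG.preconnected u x
  rw [eq_of_walk_of_forall_le w hu fun j _ => hf j]
  exact hu i

theorem eq_of_laplacian_mulVec_eq_zero (hG : G.graph.Connected) {f : V → ℝ} {x : V}
    (hf : ∀ i, i ≠ x → (G.laplacian *ᵥ f) i = 0) (i : V) : f i = f x := by
  refine le_antisymm ?_ (le_of_laplacian_mulVec_nonneg hG (fun j hj => (hf j hj).ge) i)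
  have := le_of_laplacian_mulVec_nonneg hG (f := -f) (x := x)
    (fun j hj => by simp [mulVec_neg, hf j hj]) i
  simpa using this

theorem laplacian_mulVec_pinv_mulVec (hG : G.graph.Connected) {d : V → ℝ} (hd : ∑ i, d i = 0) :
    G.laplacian *ᵥ (moorePenroseInverse G.laplacian *ᵥ d) = d := by
  obtain ⟨x⟩ := hG.nonempty
  refine (isMoorePenroseInverse_moorePenroseInverse _).mulVec_mulVec_eq_self fun z hz => ?_
  rw [G.laplacian_isSymm.eq] at hz
  have hconst : ∀ i, z i = z x := eq_of_laplacian_mulVec_eq_zero hG fun i _ => congrFun hz i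
  simp only [dotProduct, hconst, ← Finset.mul_sum, hd, mul_zero]

theorem pinv_laplacian_posSemidef (G : WeightedGraph V) :
    (moorePenroseInverse G.laplacian).PosSemidef :=
  (isMoorePenroseInverse_moorePenroseInverse _).posSemidef G.laplacian_posSemidef

end Laplacian

section Resistance

variable [Fintype V] [DecidableEq V]

/-- The matrix `Ω = (ωᵢⱼ)` of effective resistances. -/
noncomputable def resistanceMatrix (G : WeightedGraph V) : Matrix V V ℝ :=
  Matrix.of G.resistance

theorem pinv_laplacian_apply_comm (G : WeightedGraph V) (i j : V) :
    moorePenroseInverse G.laplacian i j = moorePenroseInverse G.laplacian j i :=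
  congrFun₂ ((isMoorePenroseInverse_moorePenroseInverse _).transpose_eq G.laplacian_isSymm) j i

theorem resistance_eq (G : WeightedGraph V) (i j : V) :
    G.resistance i j = moorePenroseInverse G.laplacian i i +
      moorePenroseInverse G.laplacian j j - 2 * moorePenroseInverse G.laplacian i j := by
  simp only [resistance, mulVec_sub, sub_dotProduct, dotProduct_sub, single_one_dotProduct,
    mulVec_single_one, col_apply, G.pinv_laplacian_apply_comm j i]
  ring

theorem resistance_self (G : WeightedGraph V) (i : V) : G.resistance i i = 0 := by
  rw [resistance_eq]; ring

theorem resistance_comm (G : WeightedGraph V) (i j : V) :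
    G.resistance i j = G.resistance j i := by
  rw [resistance_eq, resistance_eq, G.pinv_laplacian_apply_comm i j]; ring

theorem dotProduct_resistanceMatrix_mulVec_self (G : WeightedGraph V) {d : V → ℝ}
    (hd : ∑ i, d i = 0) :
    d ⬝ᵥ G.resistanceMatrix *ᵥ d = -2 * (d ⬝ᵥ moorePenroseInverse G.laplacian *ᵥ d) := by
  set M := moorePenroseInverse G.laplacian with hM
  have hrow : G.resistanceMatrix *ᵥ d = fun i => ∑ j, M j j * d j - 2 * (M *ᵥ d) i := by
    ext i
    simp only [resistanceMatrix, mulVec, dotProduct, of_apply, resistance_eq, ← hM, sub_mul,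
      add_mul, mul_assoc, Finset.sum_sub_distrib, Finset.sum_add_distrib, ← Finset.mul_sum, hd]
    ring
  rw [hrow]
  simp only [dotProduct, mul_sub, Finset.sum_sub_distrib, ← Finset.sum_mul, hd, zero_mul,
    mul_left_comm _ (2 : ℝ), ← Finset.mul_sum]
  ring

theorem isCondNegDef_resistanceMatrix (hG : G.graph.Connected) :
    IsCondNegDef G.resistanceMatrix where
  isSymm := by
    ext i j
    exact G.resistance_comm j i
  dotProduct_mulVec_neg d hd hd0 := by
    have hM := G.pinv_laplacian_posSemidef
    have hnonneg := hM.dotProduct_mulVec_nonneg d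
    have hne : star d ⬝ᵥ moorePenroseInverse G.laplacian *ᵥ d ≠ 0 := by
      rw [Ne, hM.dotProduct_mulVec_zero_iff]
      intro hker
      apply hd0
      rw [← laplacian_mulVec_pinv_mulVec hG hd, hker, mulVec_zero]
    rw [star_trivial] at hnonneg hne
    rw [G.dotProduct_resistanceMatrix_mulVec_self hd]
    linarith [hnonneg.lt_of_ne' hne]

theorem resistance_pos (hG : G.graph.Connected) {i j : V} (hij : i ≠ j) : 0 < G.resistance i j :=
  (isCondNegDef_resistanceMatrix hG).apply_pos G.resistance_self hij

/-- The potential at `a` of the unit current from `b` to `x`, grounded at `x`. It is defined as half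
the defect of the triangle inequality for `ω`, so that its sign and its zeros are those of the
defect; `laplacian_mulVec_potential` justifies the name. -/
noncomputable def potential (G : WeightedGraph V) (b x a : V) : ℝ :=
  (G.resistance a x + G.resistance x b - G.resistance a b) / 2

theorem potential_sink (G : WeightedGraph V) (b x : V) : G.potential b x x = 0 := by
  simp [potential, resistance_self]

theorem potential_source (G : WeightedGraph V) (b x : V) :
    G.potential b x b = G.resistance b x := by
  rw [potential, resistance_self, G.resistance_comm x b]
  ring

theorem potential_eq_zero_iff {a b x : V} :
    G.potential b x a = 0 ↔ G.resistance a x + G.resistance x b = G.resistance a b := by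
  rw [potential, div_eq_zero_iff, or_iff_left two_ne_zero, sub_eq_zero]

theorem laplacian_mulVec_potential (hG : G.graph.Connected) (b x : V) :
    G.laplacian *ᵥ G.potential b x = Pi.single b 1 - Pi.single x 1 := by
  set v := moorePenroseInverse G.laplacian *ᵥ (Pi.single b 1 - Pi.single x 1 : V → ℝ) with hv
  have hpot : ∀ i, G.potential b x i = v i - v x := by
    intro i
    simp only [potential, hv, resistance_eq, mulVec_sub, mulVec_single_one, Pi.sub_apply, col_apply]
    ring
  rw [← laplacian_mulVec_pinv_mulVec hG (d := Pi.single b 1 - Pi.single x 1)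
    (by simp [Finset.sum_sub_distrib])]
  ext i
  simp only [laplacian_mulVec, hpot, sub_sub_sub_cancel_right, hv]

theorem laplacian_mulVec_potential_nonneg (hG : G.graph.Connected) {b x i : V} (hi : i ≠ x) :
    0 ≤ (G.laplacian *ᵥ G.potential b x) i := by
  rw [laplacian_mulVec_potential hG, Pi.sub_apply, Pi.single_eq_of_ne hi, sub_zero]
  exact (Pi.single_nonneg.2 zero_le_one : (0 : V → ℝ) ≤ Pi.single b 1) i

theorem potential_nonneg (hG : G.graph.Connected) (b x a : V) : 0 ≤ G.potential b x a := by
  rw [← G.potential_sink b x]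
  exact le_of_laplacian_mulVec_nonneg hG (fun i hi => laplacian_mulVec_potential_nonneg hG hi) a

theorem resistance_triangle (hG : G.graph.Connected) (a x b : V) :
    G.resistance a b ≤ G.resistance a x + G.resistance x b := by
  have := potential_nonneg hG b x a
  rw [potential] at this
  linarith

theorem laplacian_mulVec_indicator {S : Set V} {x : V} {f : V → ℝ} (hfx : f x = 0)
    (hS : ∀ i ∈ S, ∀ j ∉ S, G.graph.Adj i j → j = x) {i : V} (hi : i ≠ x) :
    (G.laplacian *ᵥ S.indicator f) i = S.indicator (G.laplacian *ᵥ f) i := by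
  by_cases hiS : i ∈ S
  · rw [Set.indicator_of_mem hiS, laplacian_mulVec, laplacian_mulVec]
    refine Finset.sum_congr rfl fun j _ => ?_
    by_cases hj : j ∈ S
    · simp [hiS, hj]
    by_cases hij : G.graph.Adj i j
    · simp [hiS, hS i hiS j hj hij, hfx]
    · simp [G.weight_eq_zero i j hij]
  · rw [Set.indicator_of_notMem hiS, laplacian_mulVec]
    refine Finset.sum_eq_zero fun j _ => ?_
    by_cases hj : j ∈ S
    · have hij : ¬ G.graph.Adj i j := fun hadj => hi (hS j hj i hiS hadj.symm)
      simp [G.weight_eq_zero i j hij]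
    · simp [hiS, hj]

-- The potential cut off outside the side of `a` is harmonic away from `x`, hence constant.
theorem resistance_add_eq_of_separates (hG : G.graph.Connected) {a x b : V} {S : Set V}
    (ha : a ∈ S) (hx : x ∉ S) (hb : b ∉ S)
    (hS : ∀ i ∈ S, ∀ j ∉ S, G.graph.Adj i j → j = x) :
    G.resistance a x + G.resistance x b = G.resistance a b := by
  have hharm : ∀ i, i ≠ x → (G.laplacian *ᵥ S.indicator (G.potential b x)) i = 0 := by
    intro i hi
    rw [laplacian_mulVec_indicator (G.potential_sink b x) hS hi, laplacian_mulVec_potential hG,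
      Set.indicator_apply_eq_zero]
    intro hiS
    simp [hi, ne_of_mem_of_not_mem hiS hb]
  have hconst := eq_of_laplacian_mulVec_eq_zero hG hharm a
  rw [Set.indicator_of_mem ha, Set.indicator_of_notMem hx] at hconst
  exact potential_eq_zero_iff.1 hconst

theorem resistance_add_eq_of_forall_mem_support (hG : G.graph.Connected) {a x b : V}
    (h : ∀ w : G.graph.Walk a b, x ∈ w.support) :
    G.resistance a x + G.resistance x b = G.resistance a b := by
  obtain rfl | hax := eq_or_ne a x
  · rw [resistance_self, zero_add]
  refine resistance_add_eq_of_separates hG (S := {v | ∃ w : G.graph.Walk a v, x ∉ w.support})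
    ⟨.nil, by simpa using hax.symm⟩ (fun ⟨w, hw⟩ => hw w.end_mem_support)
    (fun ⟨w, hw⟩ => hw (h w)) ?_
  rintro i ⟨w, hw⟩ j hj hij
  by_contra hjx
  exact hj ⟨w.concat hij, by simp [SimpleGraph.Walk.support_concat, hw, Ne.symm hjx]⟩

-- A zero of the potential is a minimum, which spreads along a walk avoiding `x` from `a` to `b`,
-- where the potential is `ω b x > 0`.
theorem mem_support_of_resistance_add_eq (hG : G.graph.Connected) {a x b : V}
    (h : G.resistance a x + G.resistance x b = G.resistance a b) (w : G.graph.Walk a b) :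
    x ∈ w.support := by
  by_contra hx
  have ha : G.potential b x a = 0 := potential_eq_zero_iff.2 h
  have hb : G.potential b x b = G.potential b x a :=
    eq_of_walk_of_forall_le w (fun i => ha.trans_le (potential_nonneg hG b x i))
      fun i hi _ => laplacian_mulVec_potential_nonneg hG (ne_of_mem_of_not_mem hi hx)
  have hbx : b ≠ x := ne_of_mem_of_not_mem w.end_mem_support hx
  rw [ha, potential_source] at hb
  exact (resistance_pos hG hbx).ne' hb

theorem resistance_add_eq_iff_forall_mem_support (hG : G.graph.Connected) {a x b : V} :
    G.resistance a x + G.resistance x b = G.resistance a b ↔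
      ∀ w : G.graph.Walk a b, x ∈ w.support :=
  ⟨mem_support_of_resistance_add_eq hG, resistance_add_eq_of_forall_mem_support hG⟩

theorem isPathWithEnds_iff_forall_resistance_add_eq (hG : G.graph.Connected) {a b : V} :
    G.IsPathWithEnds a b ↔
      ∀ x, G.resistance a x + G.resistance x b = G.resistance a b := by
  simp only [isPathWithEnds_iff_forall_mem_support hG, resistance_add_eq_iff_forall_mem_support hG]

theorem forall_resistance_add_eq_iff_forall_ne {a b : V} :
    (∀ x, G.resistance a x + G.resistance x b = G.resistance a b) ↔
      ∀ x, x ≠ a → x ≠ b → G.resistance a x + G.resistance x b = G.resistance a b := by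
  refine ⟨fun h x _ _ => h x, fun h x => ?_⟩
  obtain rfl | hxa := eq_or_ne x a
  · rw [resistance_self, zero_add]
  obtain rfl | hxb := eq_or_ne x b
  · rw [resistance_self, add_zero]
  · exact h x hxa hxb

end Resistance

section Variance

variable [Fintype V] [DecidableEq V] {p : V → ℝ}

theorem variance_eq (G : WeightedGraph V) (p : V → ℝ) :
    G.variance p = (1 / 2) * (p ⬝ᵥ G.resistanceMatrix *ᵥ p) := by
  simp only [variance, resistanceMatrix, mulVec, dotProduct, of_apply, Finset.mul_sum, mul_assoc,
    mul_comm (G.resistance _ _)]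

theorem isMaxVarianceDistribution_iff :
    G.IsMaxVarianceDistribution p ↔ IsSimplexMaximizer G.resistanceMatrix p := by
  simp only [IsMaxVarianceDistribution, IsSimplexMaximizer, isMaxOn_iff, variance_eq,
    mul_le_mul_iff_right₀ (one_half_pos (α := ℝ))]

theorem exists_isMaxVarianceDistribution [Nonempty V] (G : WeightedGraph V) :
    ∃ p, G.IsMaxVarianceDistribution p := by
  simpa only [isMaxVarianceDistribution_iff] using exists_isSimplexMaximizer G.resistanceMatrix

namespace IsMaxVarianceDistribution

theorem unique (hG : G.graph.Connected) {q : V → ℝ} (hp : G.IsMaxVarianceDistribution p)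
    (hq : G.IsMaxVarianceDistribution q) : p = q :=
  (isMaxVarianceDistribution_iff.1 hp).unique (isCondNegDef_resistanceMatrix hG)
    (isMaxVarianceDistribution_iff.1 hq)

theorem setOf_pos_eq_pair_iff (hG : G.graph.Connected) (hp : G.IsMaxVarianceDistribution p)
    {a b : V} (hab : a ≠ b) :
    {i | 0 < p i} = {a, b} ↔
      ∀ x, G.resistance a x + G.resistance x b = G.resistance a b := by
  rw [(isMaxVarianceDistribution_iff.1 hp).setOf_pos_eq_pair_iff
    (isCondNegDef_resistanceMatrix hG) G.resistance_self hab]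
  exact forall_congr' fun x => (resistance_triangle hG a x b).ge_iff_eq'

end IsMaxVarianceDistribution

end Variance

end WeightedGraph

theorem mainTheorem9 {V : Type*} [Fintype V] [DecidableEq V] (G : WeightedGraph V)
    (hG : G.graph.Connected) :
    ∃ p : V → ℝ, G.IsMaxVarianceDistribution p ∧
      (∀ q : V → ℝ, G.IsMaxVarianceDistribution q → q = p) ∧
      (∀ a b : V, a ≠ b →
        (({i | 0 < p i} : Set V) = {a, b} ↔ G.IsPathWithEnds a b) ∧
        (({i | 0 < p i} : Set V) = {a, b} ↔
          ∀ x : V, x ≠ a → x ≠ b →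
            G.resistance a x + G.resistance x b = G.resistance a b)) ∧
      (({i | 0 < p i} : Set V).ncard = 2 ↔ ∃ a b : V, a ≠ b ∧ G.IsPathWithEnds a b) := by
  have := hG.nonempty
  obtain ⟨p, hp⟩ := G.exists_isMaxVarianceDistribution
  have hpair (a b : V) (hab : a ≠ b) := hp.setOf_pos_eq_pair_iff hG hab
  have hpath (a b : V) (hab : a ≠ b) : ({i | 0 < p i} : Set V) = {a, b} ↔ G.IsPathWithEnds a b :=
    (hpair a b hab).trans (WeightedGraph.isPathWithEnds_iff_forall_resistance_add_eq hG).symm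
  refine ⟨p, hp, fun q hq => hq.unique hG hp, fun a b hab => ⟨hpath a b hab,
    (hpair a b hab).trans WeightedGraph.forall_resistance_add_eq_iff_forall_ne⟩, ?_⟩
  rw [Set.ncard_eq_two]
  exact exists_congr fun a => exists_congr fun b => and_congr_right fun hab => hpath a b hab
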